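/- **Theorem 2.3.** Let $\Lambda$ be a left and right Noetherian ring and let $k$ be a positive integer. For a finitely generated left $\Lambda$-module $M$ and an integer $i\ge 0$, write $\operatorname{grade} M\ge i$ if $\operatorname{Ext}_\Lambda^j(M,\Lambda)=0$ for all $0\le j<i$, and, for $i\ge 1$, write $\operatorname{r.grade} M\ge i$ if $\operatorname{Ext}_\Lambda^j(M,\Lambda)=0$ for all $1\le j<i$. Assume that $\Lambda$ is right quasi $k$-Gorenstein, i.e. for every finitely generated right $\Lambda$-module $N$ and every $1\le i\le k$, the left $\Lambda$-module $\operatorname{Ext}_{\Lambda^{op}}^i(N,\Lambda)$ satisfies $\operatorname{grade}\operatorname{Ext}_{\Lambda^{op}}^i(N,\Lambda)\ge i$. Let $(\ )^*=\operatorname{Hom}(\ ,\Lambda)$ and let $\sigma_M:M\to M^{**}$, $\sigma_M(x)(f)=f(x)$, be the canonical evaluation homomorphism; $M$ is called torsionless if $\sigma_M$ is injective, and reflexive if $\sigma_M$ is an isomorphism. Then the following statements are equivalent. 1. The injective dimension of $\Lambda$ as a right $\Lambda$-module satisfies $\operatorname{id}_{\Lambda^{op}}\Lambda\le k$. 2.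 Every finitely generated left $\Lambda$-module $M$ with $\operatorname{r.grade} M\ge k+1$ (that is, $\operatorname{Ext}_\Lambda^i(M,\Lambda)=0$ for all $1\le i\le k$) is reflexive. 3. Every finitely generated left $\Lambda$-module $M$ with $\operatorname{r.grade} M\ge k+1$ is torsionless. -/

import Mathlib

open CategoryTheory

universe u

namespace QuasiGorenstein

noncomputable section

/-! Left modules over `Λ` are objects of `ModuleCat.{u} Λ`; right modules over `Λ` are left modules
over `Λᵐᵒᵖ`. The left regular module is `ModuleCat.of Λ Λ` and the right regular module is
`ModuleCat.of Λᵐᵒᵖ Λ`, where `MulOpposite.op a • x = x * a`. -/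

section Dual

variable (Λ : Type u) [Ring Λ] (M : Type u) [AddCommGroup M] [Module Λ M]

/-- The dual `M* = Hom_Λ(M, Λ)` of a left `Λ`-module. It is a right `Λ`-module by
`(f a)(x) = f(x) a`. -/
abbrev LeftDual : Type u := M →ₗ[Λ] Λ

/-- The double dual `M** = Hom_{Λᵒᵖ}(M*, Λ)` of a left `Λ`-module. It is a left `Λ`-module by
`(a φ)(f) = a φ(f)`. -/
abbrev LeftDoubleDual : Type u := LeftDual Λ M →ₗ[Λᵐᵒᵖ] Λ

/-- The canonical evaluation homomorphism `σ_M : M → M**`, `σ_M(x)(f) = f(x)`. -/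
def evalDoubleDual : M →ₗ[Λ] LeftDoubleDual Λ M where
  toFun x :=
    { toFun := fun f => f x
      map_add' := fun _ _ => rfl
      map_smul' := fun _ _ => rfl }
  map_add' x y := by
    ext f
    exact map_add f x y
  map_smul' a x := by
    ext f
    exact map_smul f a x

/-- `M` is torsionless if `σ_M` is a monomorphism. -/
def IsTorsionless : Prop := Function.Injective (evalDoubleDual Λ M)

/-- `M` is reflexive if `σ_M` is an isomorphism. -/
def IsReflexive : Prop := Function.Bijective (evalDoubleDual Λ M)

end Dual

section Grade

variable {Λ : Type u} [Ring Λ]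

/-- `grade M ≥ i`: `Ext_Λ^j(M, Λ) = 0` for `0 ≤ j < i`. -/
def GradeGE (M : ModuleCat.{u} Λ) (i : ℕ) : Prop :=
  ∀ j : ℕ, j < i → Subsingleton (Abelian.Ext M (ModuleCat.of Λ Λ) j)

/-- `r.grade M ≥ i`: `Ext_Λ^j(M, Λ) = 0` for `1 ≤ j < i`. -/
def ReducedGradeGE (M : ModuleCat.{u} Λ) (i : ℕ) : Prop :=
  ∀ j : ℕ, 1 ≤ j → j < i → Subsingleton (Abelian.Ext M (ModuleCat.of Λ Λ) j)

end Grade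

section RightExt

variable (Λ : Type u) [Ring Λ]

/-- Left multiplication by `a`, as an endomorphism of the right regular module. -/
def leftMul (a : Λ) : ModuleCat.of Λᵐᵒᵖ Λ ⟶ ModuleCat.of Λᵐᵒᵖ Λ :=
  ModuleCat.ofHom (Module.toModuleEnd Λᵐᵒᵖ Λ a)

lemma leftMul_apply (a x : Λ) : (leftMul Λ a).hom x = a * x := rfl

lemma leftMul_one : leftMul Λ 1 = 𝟙 _ := by
  ext : 1
  exact map_one (Module.toModuleEnd Λᵐᵒᵖ Λ)

lemma leftMul_mul (a b : Λ) : leftMul Λ (a * b) = leftMul Λ b ≫ leftMul Λ a := by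
  ext : 1
  exact map_mul (Module.toModuleEnd Λᵐᵒᵖ Λ) a b

lemma leftMul_add (a b : Λ) : leftMul Λ (a + b) = leftMul Λ a + leftMul Λ b := by
  ext : 1
  exact map_add (Module.toModuleEnd Λᵐᵒᵖ Λ) a b

lemma leftMul_zero : leftMul Λ 0 = 0 := by
  ext : 1
  exact map_zero (Module.toModuleEnd Λᵐᵒᵖ Λ)

/-- The left `Λ`-module structure on `Ext_{Λᵒᵖ}^i(N, Λ)` for a right `Λ`-module `N`: the ring
element `a` acts through the functor `Ext_{Λᵒᵖ}^i(N, -)` applied to left multiplication by `a`. -/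
@[reducible]
def rightExtModule (N : ModuleCat.{u} Λᵐᵒᵖ) (i : ℕ) :
    Module Λ (Abelian.Ext N (ModuleCat.of Λᵐᵒᵖ Λ) i) where
  smul a e := e.comp (Abelian.Ext.mk₀ (leftMul Λ a)) (add_zero i)
  one_smul e := by
    change e.comp (Abelian.Ext.mk₀ (leftMul Λ 1)) (add_zero i) = e
    rw [leftMul_one, Abelian.Ext.comp_mk₀_id]
  mul_smul a b e := by
    change e.comp (Abelian.Ext.mk₀ (leftMul Λ (a * b))) (add_zero i) =
      (e.comp (Abelian.Ext.mk₀ (leftMul Λ b)) (add_zero i)).comp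
        (Abelian.Ext.mk₀ (leftMul Λ a)) (add_zero i)
    rw [leftMul_mul, Abelian.Ext.comp_assoc_of_third_deg_zero, Abelian.Ext.mk₀_comp_mk₀]
  smul_zero a := Abelian.Ext.zero_comp _ _ _ _ _
  smul_add a e f := Abelian.Ext.add_comp _ _ _ _
  add_smul a b e := by
    change e.comp (Abelian.Ext.mk₀ (leftMul Λ (a + b))) (add_zero i) =
      e.comp (Abelian.Ext.mk₀ (leftMul Λ a)) (add_zero i) +
        e.comp (Abelian.Ext.mk₀ (leftMul Λ b)) (add_zero i)
    rw [leftMul_add, Abelian.Ext.mk₀_add, Abelian.Ext.comp_add]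
  zero_smul e := by
    change e.comp (Abelian.Ext.mk₀ (leftMul Λ 0)) (add_zero i) = 0
    rw [leftMul_zero, Abelian.Ext.mk₀_zero, Abelian.Ext.comp_zero]

/-- The left `Λ`-module `Ext_{Λᵒᵖ}^i(N, Λ)` for a right `Λ`-module `N`. -/
def rightExt (N : ModuleCat.{u} Λᵐᵒᵖ) (i : ℕ) : ModuleCat.{u} Λ :=
  letI := rightExtModule Λ N i
  ModuleCat.of Λ (Abelian.Ext N (ModuleCat.of Λᵐᵒᵖ Λ) i)

/-- `Λ` is right quasi `k`-Gorenstein: for every finitely generated right `Λ`-module `N` and every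
`1 ≤ i ≤ k`, the left `Λ`-module `Ext_{Λᵒᵖ}^i(N, Λ)` has grade at least `i`. -/
def IsRightQuasiGorenstein (k : ℕ) : Prop :=
  ∀ N : ModuleCat.{u} Λᵐᵒᵖ, Module.Finite Λᵐᵒᵖ N →
    ∀ i : ℕ, 1 ≤ i → i ≤ k → GradeGE (rightExt Λ N i) i

end RightExt

end

end QuasiGorenstein

/-!
The argument works with free presentations `P₂ → P₁ → P₀ → N → 0`, the transpose of `N` (the cokernel
of `P₀* → P₁*`), and the image of `P₀* → P₁*`, called `DualImage N`, for which
`0 → N* → P₀* → DualImage N → 0` and `0 → DualImage N → P₁* → Transpose N → 0` are exact. The one fact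
about `Λ` that enters is that finitely generated free modules are reflexive: every functional on the
dual is an evaluation (`exists_eq_eval`).

Finite injective dimension implies reflexivity. If `Ext^i(M, Λ) = 0` for `1 ≤ i ≤ n`, then
`DualImage M` is an `(n + 1)`-st syzygy, so `Ext^j(DualImage M, Λ) = 0` for `j ≥ max(1, k - n)` when
the injective dimension is at most `k` (`extZero_dualImage`). With `n = k` this gives
`Ext¹(DualImage M, Λ) = 0`, so that functionals on `M*` extend to `P₀*`, where they are evaluations,
and `σ_M` is onto. The same holds for the syzygy of `M`, where `n = k - 1` suffices, and surjectivity
of `σ` for the syzygy is injectivity of `σ_M`, because `Ext¹(M, Λ) = 0`.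

Torsionlessness implies finite injective dimension. By Baer's criterion it is enough that
`Ext^{k+1}(N, Λ) = 0` for every finitely generated right module `N`, that is `Ext¹(L, Λ) = 0` for the
`k`-th syzygy `L` of `N`. The kernel of `σ` on the transpose of `L` is `Ext¹(L, Λ)`, so it is enough
that the transpose is torsionless (`extZero_one_of_transpose`), for which it has to satisfy the
vanishing condition in degrees `1, …, k`. Here the quasi Gorenstein condition enters: `Ext¹(N, Λ)` is
the kernel of the map from the transpose of `N` onto `DualImage` of its syzygy, so a lower bound on
its grade turns vanishing for the transpose of `N` in degrees `1, …, n` into vanishing for the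
transpose of its syzygy in degrees `1, …, n + 1` (`extZero_transpose_syzygy`). Iterating uses
`Ext¹(Ω^{i-1} N, Λ) ≅ Ext^i(N, Λ)` as left `Λ`-modules (`rightExt_shift`, `rightExt_one`).
-/

namespace QuasiGorenstein

/-! ### Vanishing of `Ext` along short exact sequences of modules -/

section ExtVanishing

variable (R : Type u) [Ring R]

/-- `Ext_R^n(A, D) = 0`, for unbundled modules. -/
abbrev ExtZero (A D : Type u) [AddCommGroup A] [Module R A] [AddCommGroup D] [Module R D]
    (n : ℕ) : Prop :=
  Subsingleton (Abelian.Ext (ModuleCat.of R A) (ModuleCat.of R D) n)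

variable {R}
variable {A B C D : Type u} [AddCommGroup A] [Module R A] [AddCommGroup B] [Module R B]
  [AddCommGroup C] [Module R C] [AddCommGroup D] [Module R D] {f : A →ₗ[R] B} {g : B →ₗ[R] C}

lemma shortExact_of_exact (hf : Function.Injective f) (hfg : Function.Exact f g)
    (hg : Function.Surjective g) :
    (ModuleCat.shortComplexOfCompEqZero f g hfg.linearMap_comp_eq_zero).ShortExact :=
  ModuleCat.shortComplex_shortExact _ hfg hf hg

lemma extZero_of_projective [Module.Projective R B] (n : ℕ) : ExtZero R B D (n + 1) :=
  have : Projective (ModuleCat.of R B) := (IsProjective.iff_projective B).mp inferInstance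
  Abelian.Ext.subsingleton_of_projective _ _ n

lemma extZero_left (hf : Function.Injective f) (hfg : Function.Exact f g)
    (hg : Function.Surjective g) {n : ℕ} (hB : ExtZero R B D n) (hC : ExtZero R C D (n + 1)) :
    ExtZero R A D n := by
  refine subsingleton_of_forall_eq 0 fun e => ?_
  obtain ⟨x, rfl⟩ := Abelian.Ext.contravariant_sequence_exact₁ (shortExact_of_exact hf hfg hg)
    (ModuleCat.of R D) e (add_comm 1 n) (hC.elim _ _)
  rw [hB.elim x 0, Abelian.Ext.comp_zero]

lemma extZero_right (hf : Function.Injective f) (hfg : Function.Exact f g)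
    (hg : Function.Surjective g) {n : ℕ} (hA : ExtZero R A D n) (hB : ExtZero R B D (n + 1)) :
    ExtZero R C D (n + 1) := by
  refine subsingleton_of_forall_eq 0 fun e => ?_
  obtain ⟨x, rfl⟩ := Abelian.Ext.contravariant_sequence_exact₃ (shortExact_of_exact hf hfg hg)
    (ModuleCat.of R D) e (hB.elim _ _) (add_comm 1 n)
  rw [hA.elim x 0, Abelian.Ext.comp_zero]

/-- If `B` is projective, then `Ext¹(C, D)` is the obstruction to extending maps `A → D` to `B`. -/
lemma extZero_one_iff [Module.Projective R B] (hf : Function.Injective f)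
    (hfg : Function.Exact f g) (hg : Function.Surjective g) :
    ExtZero R C D 1 ↔ Function.Surjective fun ψ : B →ₗ[R] D => ψ ∘ₗ f := by
  constructor
  · intro h φ
    obtain ⟨x, hx⟩ := Abelian.Ext.contravariant_sequence_exact₁ (shortExact_of_exact hf hfg hg)
      (ModuleCat.of R D) (Abelian.Ext.mk₀ (ModuleCat.ofHom φ)) (add_comm 1 0) (h.elim _ _)
    obtain ⟨ψ, rfl⟩ := Abelian.Ext.homEquiv₀.symm.surjective x
    refine ⟨ψ.hom, ?_⟩
    have : ModuleCat.ofHom f ≫ ψ = ModuleCat.ofHom φ :=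
      Abelian.Ext.homEquiv₀.symm.injective (by simpa using hx)
    simpa using congrArg ModuleCat.Hom.hom this
  · intro h
    refine subsingleton_of_forall_eq 0 fun e => ?_
    obtain ⟨x, rfl⟩ := Abelian.Ext.contravariant_sequence_exact₃ (shortExact_of_exact hf hfg hg)
      (ModuleCat.of R D) e ((extZero_of_projective 0).elim _ _) (add_comm 1 0)
    obtain ⟨φ, rfl⟩ := Abelian.Ext.homEquiv₀.symm.surjective x
    obtain ⟨ψ, hψ⟩ := h φ.hom
    have : φ = ModuleCat.ofHom f ≫ ModuleCat.ofHom ψ := by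
      ext : 1
      exact hψ.symm
    have h0 := (shortExact_of_exact hf hfg hg).extClass_comp_assoc
      (Abelian.Ext.mk₀ (ModuleCat.ofHom ψ)) (h := add_comm 1 0)
    simpa [this] using h0

lemma GradeGE.of_linearEquiv {X Y : ModuleCat.{u} R} (e : X ≃ₗ[R] Y) {n : ℕ}
    (h : GradeGE X n) : GradeGE Y n := by
  intro j hj
  have := h j hj
  refine subsingleton_of_forall_eq 0 fun x => ?_
  have : x = (Abelian.Ext.mk₀ e.toModuleIso.inv).comp
      ((Abelian.Ext.mk₀ e.toModuleIso.hom).comp x (zero_add j)) (zero_add j) := by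
    rw [Abelian.Ext.mk₀_comp_mk₀_assoc, Iso.inv_hom_id, Abelian.Ext.mk₀_id_comp]
  rw [this, Subsingleton.elim ((Abelian.Ext.mk₀ e.toModuleIso.hom).comp x (zero_add j)) 0,
    Abelian.Ext.comp_zero]

/-- Baer's criterion for injective dimension: it suffices to test on finitely generated modules,
in a single degree. -/
lemma hasInjectiveDimensionLE_of_finite (k : ℕ) (Y : ModuleCat.{u} R)
    (h : ∀ X : ModuleCat.{u} R, Module.Finite R X → Subsingleton (Abelian.Ext X Y (k + 1))) :
    HasInjectiveDimensionLE Y k := by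
  induction k generalizing Y with
  | zero =>
    rw [HasInjectiveDimensionLE, ← injective_iff_hasInjectiveDimensionLT_one]
    have hBaer : Module.Baer R Y := fun I φ => by
      have hX := h (ModuleCat.of R (R ⧸ I)) inferInstance
      obtain ⟨ψ, hψ⟩ := (extZero_one_iff (D := Y) I.injective_subtype
        (LinearMap.exact_subtype_mkQ I) I.mkQ_surjective).mp hX φ
      exact ⟨ψ, fun x hx => LinearMap.congr_fun hψ ⟨x, hx⟩⟩
    have := hBaer.injective
    exact Module.injective_object_of_injective_module R Y
  | succ k ih =>
    obtain ⟨I, _, i, _⟩ := EnoughInjectives.presentation Y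
    have hS : (ShortComplex.mk i (Limits.cokernel.π i) (Limits.cokernel.condition i)).ShortExact :=
      { exact := ShortComplex.exact_cokernel i }
    refine (hS.hasInjectiveDimensionLT_X₃_iff k inferInstance).mp (ih _ fun X hX => ?_)
    have := h X hX
    refine subsingleton_of_forall_eq 0 fun e => ?_
    obtain ⟨x, rfl⟩ := Abelian.Ext.covariant_sequence_exact₃ X hS e rfl (this.elim _ _)
    rw [Abelian.Ext.eq_zero_of_injective x, Abelian.Ext.zero_comp]

end ExtVanishing

/-! ### The left module structure on `Ext` of right modules -/

section RightExt

variable {Λ : Type u} [Ring Λ]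
variable {A B C : Type u} [AddCommGroup A] [Module Λᵐᵒᵖ A] [AddCommGroup B] [Module Λᵐᵒᵖ B]
  [AddCommGroup C] [Module Λᵐᵒᵖ C] {f : A →ₗ[Λᵐᵒᵖ] B} {g : B →ₗ[Λᵐᵒᵖ] C}

/-- Dimension shifting is `Λ`-linear: the connecting map is left composition with the class of the
extension, while `Λ` acts by composition on the right. -/
lemma rightExt_shift [Module.Projective Λᵐᵒᵖ B] (hf : Function.Injective f)
    (hfg : Function.Exact f g) (hg : Function.Surjective g) (m : ℕ) :
    Nonempty (rightExt Λ (ModuleCat.of Λᵐᵒᵖ A) (m + 1) ≃ₗ[Λ]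
      rightExt Λ (ModuleCat.of Λᵐᵒᵖ C) (m + 2)) := by
  have hS := shortExact_of_exact hf hfg hg
  let δ : rightExt Λ (ModuleCat.of Λᵐᵒᵖ A) (m + 1) →ₗ[Λ]
      rightExt Λ (ModuleCat.of Λᵐᵒᵖ C) (m + 2) :=
    { toFun := fun e => hS.extClass.comp e (add_comm 1 (m + 1))
      map_add' := fun e e' => Abelian.Ext.comp_add _ _ _ _
      map_smul' := fun a e => (Abelian.Ext.comp_assoc_of_third_deg_zero hS.extClass e
        (Abelian.Ext.mk₀ (leftMul Λ a)) (add_comm 1 (m + 1))).symm }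
  refine ⟨LinearEquiv.ofBijective δ ⟨?_, fun e => ?_⟩⟩
  · rw [injective_iff_map_eq_zero]
    intro e he
    obtain ⟨x, rfl⟩ := Abelian.Ext.contravariant_sequence_exact₁ hS _ e (add_comm 1 (m + 1)) he
    have : x = 0 := (extZero_of_projective (B := B) m).elim _ _
    rw [this]
    exact Abelian.Ext.comp_zero (Abelian.Ext.mk₀ (ModuleCat.ofHom f)) _ _ _ (zero_add _)
  · exact Abelian.Ext.contravariant_sequence_exact₃ hS _ e
      ((extZero_of_projective (B := B) (m + 1)).elim _ _) (add_comm 1 (m + 1))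

/-- For `0 → A → B → C → 0` with `B` projective, `Ext¹(C, Λ)` is the cokernel of `B* → A*`, as a
left `Λ`-module. -/
lemma rightExt_one [Module.Projective Λᵐᵒᵖ B] (hf : Function.Injective f)
    (hfg : Function.Exact f g) (hg : Function.Surjective g) :
    Nonempty (rightExt Λ (ModuleCat.of Λᵐᵒᵖ C) 1 ≃ₗ[Λ]
      ((A →ₗ[Λᵐᵒᵖ] Λ) ⧸ LinearMap.range (f.lcomp Λ Λ))) := by
  have hS := shortExact_of_exact hf hfg hg
  let δ : (A →ₗ[Λᵐᵒᵖ] Λ) →ₗ[Λ] rightExt Λ (ModuleCat.of Λᵐᵒᵖ C) 1 :=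
    { toFun := fun φ => hS.extClass.comp (Abelian.Ext.mk₀
        (ModuleCat.ofHom φ : ModuleCat.of Λᵐᵒᵖ A ⟶ ModuleCat.of Λᵐᵒᵖ Λ)) (add_zero 1)
      map_add' := fun φ φ' => by
        rw [ModuleCat.ofHom_add, Abelian.Ext.mk₀_add]
        exact Abelian.Ext.comp_add _ _ _ _
      map_smul' := fun a φ => by
        have : (ModuleCat.ofHom (a • φ) : ModuleCat.of Λᵐᵒᵖ A ⟶ ModuleCat.of Λᵐᵒᵖ Λ) =
            ModuleCat.ofHom φ ≫ leftMul Λ a := rfl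
        rw [this, ← Abelian.Ext.mk₀_comp_mk₀]
        exact (Abelian.Ext.comp_assoc_of_third_deg_zero hS.extClass _
          (Abelian.Ext.mk₀ (leftMul Λ a)) (add_zero 1)).symm }
  have hδ : Function.Surjective δ := fun e => by
    obtain ⟨x, hx⟩ := Abelian.Ext.contravariant_sequence_exact₃ hS (ModuleCat.of Λᵐᵒᵖ Λ) e
      ((extZero_of_projective (B := B) 0).elim _ _) (add_comm 1 0)
    obtain ⟨φ, rfl⟩ := Abelian.Ext.homEquiv₀.symm.surjective x
    exact ⟨φ.hom, hx⟩
  have hker : LinearMap.range (f.lcomp Λ Λ) = LinearMap.ker δ := by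
    ext φ
    constructor
    · rintro ⟨ψ, rfl⟩
      have h0 := hS.extClass_comp_assoc (Abelian.Ext.mk₀
        (ModuleCat.ofHom ψ : ModuleCat.of Λᵐᵒᵖ B ⟶ ModuleCat.of Λᵐᵒᵖ Λ)) (h := add_comm 1 0)
      rw [Abelian.Ext.mk₀_comp_mk₀] at h0
      exact h0
    · intro hφ
      obtain ⟨x, hx⟩ := Abelian.Ext.contravariant_sequence_exact₁ hS (ModuleCat.of Λᵐᵒᵖ Λ)
        (Abelian.Ext.mk₀ (ModuleCat.ofHom φ)) (add_comm 1 0) hφ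
      obtain ⟨ψ, rfl⟩ := Abelian.Ext.homEquiv₀.symm.surjective x
      refine ⟨ψ.hom, ?_⟩
      have : ModuleCat.ofHom f ≫ ψ = ModuleCat.ofHom φ :=
        Abelian.Ext.homEquiv₀.symm.injective (by simpa using hx)
      exact congrArg ModuleCat.Hom.hom this
  exact ⟨((Submodule.quotEquivOfEq _ _ hker).trans (δ.quotKerEquivOfSurjective hδ)).symm⟩

end RightExt

/-! ### Duals with respect to a bimodule -/

/-- An `R`-`S`-bimodule `D` that behaves like a ring over itself: it is finitely generated projective
over `S` and `R` is its full ring of `S`-endomorphisms. The two instances are `Λ` as a bimodule over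
`Λ` and `Λᵐᵒᵖ`, in either order, so that every statement about the dual `A ↦ (A →ₗ[R] D)` covers both
left and right modules. -/
class IsRegularBimodule (R S D : Type u) [Ring R] [Ring S] [AddCommGroup D] [Module R D]
    [Module S D] : Prop where
  projective : Module.Projective S D
  finite : Module.Finite S D
  faithful (r : R) : (∀ x : D, r • x = 0) → r = 0
  exists_smul (φ : D →ₗ[S] D) : ∃ r : R, ∀ x, φ x = r • x

instance (Λ : Type u) [Ring Λ] : IsRegularBimodule Λ Λᵐᵒᵖ Λ where
  projective := Module.Projective.of_equiv (MulOpposite.opLinearEquiv Λᵐᵒᵖ : Λ ≃ₗ[Λᵐᵒᵖ] Λᵐᵒᵖ).symm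
  finite := Module.Finite.equiv (MulOpposite.opLinearEquiv Λᵐᵒᵖ : Λ ≃ₗ[Λᵐᵒᵖ] Λᵐᵒᵖ).symm
  faithful r h := by simpa using h 1
  exists_smul φ := ⟨φ 1, fun x => by simpa using φ.map_smul (MulOpposite.op x) 1⟩

instance (Λ : Type u) [Ring Λ] : IsRegularBimodule Λᵐᵒᵖ Λ Λ where
  projective := inferInstance
  finite := inferInstance
  faithful r h := by simpa using h 1
  exists_smul φ := ⟨MulOpposite.op (φ 1), fun x => by simpa using φ.map_smul x 1⟩

lemma exists_comp_eq_of_surjective {R A B C : Type*} [Ring R] [AddCommGroup A] [Module R A]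
    [AddCommGroup B] [Module R B] [AddCommGroup C] [Module R C] {g : A →ₗ[R] B}
    (hg : Function.Surjective g) (h : A →ₗ[R] C) (hgh : ∀ x, g x = 0 → h x = 0) :
    ∃ φ : B →ₗ[R] C, φ ∘ₗ g = h := by
  let e := g.quotKerEquivOfSurjective hg
  refine ⟨((LinearMap.ker g).liftQ h hgh) ∘ₗ e.symm.toLinearMap, ?_⟩
  ext x
  have : e.symm (g x) = Submodule.Quotient.mk x := by
    rw [LinearEquiv.symm_apply_eq]
    rfl
  exact congrArg ((LinearMap.ker g).liftQ h hgh) this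

/-- Finitely generated free modules are torsionless. -/
lemma eq_zero_of_forall_dual {R : Type u} (S D : Type u) [Ring R] [Ring S] [AddCommGroup D]
    [Module R D] [Module S D] [IsRegularBimodule R S D] {n : ℕ} {q : Fin n → R}
    (hq : ∀ h : (Fin n → R) →ₗ[R] D, h q = 0) : q = 0 := by
  ext i
  exact IsRegularBimodule.faithful S (D := D) _ fun x =>
    hq ((LinearMap.toSpanSingleton R D x) ∘ₗ LinearMap.proj i)

lemma exact_rangeRestrict {R A B C : Type*} [Ring R] [AddCommGroup A] [Module R A]
    [AddCommGroup B] [Module R B] [AddCommGroup C] [Module R C] {f : A →ₗ[R] B} {g : B →ₗ[R] C}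
    (h : Function.Exact f g) : Function.Exact f g.rangeRestrict := fun x =>
  Subtype.ext_iff.trans (h x)

section Dual

variable {R : Type u} (S D : Type u) [Ring R] [Ring S] [AddCommGroup D] [Module R D] [Module S D]
  [SMulCommClass R S D] [IsRegularBimodule R S D]

instance projective_dual (n : ℕ) : Module.Projective S ((Fin n → R) →ₗ[R] D) :=
  have := IsRegularBimodule.projective R (S := S) (D := D)
  Module.Projective.of_equiv (DirectSum.linearEquivFunOnFintype S (Fin n) (fun _ => D) ≪≫ₗ
    (Pi.basisFun R (Fin n)).constr S)

instance finite_dual (n : ℕ) : Module.Finite S ((Fin n → R) →ₗ[R] D) :=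
  have := IsRegularBimodule.finite R (S := S) (D := D)
  Module.Finite.equiv ((Pi.basisFun R (Fin n)).constr S : (Fin n → D) ≃ₗ[S] _)

variable {S D}

/-- Finitely generated free modules are reflexive: every functional on the dual is an evaluation. -/
lemma exists_eq_eval {n : ℕ} (Φ : ((Fin n → R) →ₗ[R] D) →ₗ[S] D) :
    ∃ q : Fin n → R, ∀ h, Φ h = h q := by
  let b := (Pi.basisFun R (Fin n)).constr S (M' := D)
  choose r hr using fun i => IsRegularBimodule.exists_smul (R := R)
    (Φ ∘ₗ b.toLinearMap ∘ₗ LinearMap.single S (fun _ => D) i)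
  refine ⟨r, fun h => ?_⟩
  have key : ∀ d : Fin n → D, Φ (b d) = b d r := fun d => by
    have hd : d = ∑ i, Pi.single i (d i) := (Finset.univ_sum_single d).symm
    have h1 : b d r = ∑ i, r i • d i := by
      simp [b, Module.Basis.constr_apply_fintype]
    rw [h1]
    conv_lhs => rw [hd, map_sum, map_sum]
    exact Finset.sum_congr rfl fun i _ => hr i (d i)
  simpa using key (b.symm h)

end Dual

/-! ### Free covers, syzygies and transposes -/

section Cover

variable (R : Type u) [Ring R] (N : Type u) [AddCommGroup N] [Module R N] [Module.Finite R N]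

/-- The number of generators in a chosen finite generating family of `N`. -/
noncomputable def coverRank : ℕ := (Module.Finite.exists_fin' R N).choose

/-- A chosen surjection onto `N` from a finitely generated free module. -/
noncomputable def cover : (Fin (coverRank R N) → R) →ₗ[R] N :=
  (Module.Finite.exists_fin' R N).choose_spec.choose

lemma cover_surjective : Function.Surjective (cover R N) :=
  (Module.Finite.exists_fin' R N).choose_spec.choose_spec

/-- The first syzygy of `N`, the kernel of the chosen free cover. -/
noncomputable abbrev Syzygy : Submodule R (Fin (coverRank R N) → R) := LinearMap.ker (cover R N)

variable [IsNoetherianRing R]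

/-- The differential `P₁ → P₀` of the free presentation of `N` that covers `N` and its syzygy. -/
noncomputable def presentation :
    (Fin (coverRank R (Syzygy R N)) → R) →ₗ[R] (Fin (coverRank R N) → R) :=
  (Syzygy R N).subtype ∘ₗ cover R (Syzygy R N)

lemma range_presentation : LinearMap.range (presentation R N) = Syzygy R N := by
  rw [presentation, LinearMap.range_comp, LinearMap.range_eq_top.mpr (cover_surjective _ _),
    Submodule.map_top, Submodule.range_subtype]

lemma cover_presentation (x) : cover R N (presentation R N x) = 0 :=
  (cover R (Syzygy R N) x).2

lemma exact_presentation :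
    Function.Exact (presentation R (Syzygy R N)) (presentation R N) := by
  refine LinearMap.exact_iff.mpr ?_
  rw [range_presentation, presentation, LinearMap.ker_comp, Submodule.ker_subtype]
  rfl

variable (S D : Type u) [Ring S] [AddCommGroup D] [Module R D] [Module S D] [SMulCommClass R S D]

/-- The image of `P₀* → P₁*`, where `P₁ → P₀ → N → 0` is the chosen free presentation. -/
noncomputable abbrev DualImage : Submodule S ((Fin (coverRank R (Syzygy R N)) → R) →ₗ[R] D) :=
  LinearMap.range ((presentation R N).lcomp S D)

/-- The transpose of `N`, the cokernel of `P₀* → P₁*`. -/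
noncomputable abbrev Transpose : Type u :=
  ((Fin (coverRank R (Syzygy R N)) → R) →ₗ[R] D) ⧸ DualImage R N S D

end Cover

section Sequences

variable {R : Type u} [Ring R] {N : Type u} [AddCommGroup N] [Module R N] [Module.Finite R N]
variable {S D : Type u} [Ring S] [AddCommGroup D] [Module R D] [Module S D] [SMulCommClass R S D]

lemma dual_cover_injective : Function.Injective ((cover R N).lcomp S D) :=
  LinearMap.lcomp_injective_of_surjective _ (cover_surjective R N)

lemma extZero_syzygy {n : ℕ} (h : ExtZero R N D (n + 2)) : ExtZero R (Syzygy R N) D (n + 1) :=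
  extZero_left (Syzygy R N).injective_subtype (LinearMap.exact_subtype_ker_map _)
    (cover_surjective R N) (extZero_of_projective n) h

lemma dual_subtype_surjective (h : ExtZero R N D 1) :
    Function.Surjective fun ψ : (Fin (coverRank R N) → R) →ₗ[R] D => ψ ∘ₗ (Syzygy R N).subtype :=
  (extZero_one_iff (Syzygy R N).injective_subtype (LinearMap.exact_subtype_ker_map _)
    (cover_surjective R N)).mp h

variable [IsNoetherianRing R]

/-- A functional on `P₀` that dies on `P₁` comes from `N`. -/
lemma exists_comp_cover_eq {h : (Fin (coverRank R N) → R) →ₗ[R] D}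
    (hh : h ∘ₗ presentation R N = 0) : ∃ φ : N →ₗ[R] D, φ ∘ₗ cover R N = h := by
  refine exists_comp_eq_of_surjective (cover_surjective R N) h fun x hx => ?_
  obtain ⟨y, rfl⟩ : x ∈ LinearMap.range (presentation R N) := by
    rw [range_presentation]
    exact hx
  exact LinearMap.congr_fun hh y

lemma exact_dual_cover :
    Function.Exact ((cover R N).lcomp S D) ((presentation R N).lcomp S D) := by
  intro h
  constructor
  · exact exists_comp_cover_eq
  · rintro ⟨φ, rfl⟩
    exact LinearMap.ext fun x => (congrArg φ (cover_presentation R N x)).trans (map_zero φ)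

lemma dualImage_le_ker : DualImage R N S D ≤
    LinearMap.ker ((presentation R (Syzygy R N)).lcomp S D) := by
  rintro _ ⟨ψ, rfl⟩
  refine LinearMap.ext fun y => ?_
  exact (congrArg (ψ ∘ₗ (Syzygy R N).subtype) (cover_presentation R (Syzygy R N) y)).trans
    (map_zero _)

/-- If `Ext¹(N, D) = 0`, then `DualImage N` is the dual of the syzygy of `N`, so it is the kernel of
`P₁* → P₂*`. -/
lemma exact_dualImage (h : ExtZero R N D 1) : Function.Exact (DualImage R N S D).subtype
    ((presentation R (Syzygy R N)).lcomp S D) := by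
  intro x
  constructor
  · intro hx
    obtain ⟨φ, rfl⟩ := exists_comp_cover_eq hx
    obtain ⟨ψ, rfl⟩ := dual_subtype_surjective h φ
    exact ⟨⟨_, ψ, rfl⟩, rfl⟩
  · rintro ⟨y, rfl⟩
    exact dualImage_le_ker y.2

end Sequences

/-! ### Finite injective dimension makes modules with vanishing `Ext` reflexive -/

section Reflexive

variable {R : Type u} [Ring R] [IsNoetherianRing R]
variable {S D : Type u} [Ring S] [AddCommGroup D] [Module R D] [Module S D] [SMulCommClass R S D]
  [IsRegularBimodule R S D]

/-- The vanishing of `Ext^i(M, D)` for `1 ≤ i ≤ n` makes `DualImage M` an `(n + 1)`-st syzygy, which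
lowers the degree from which its `Ext` vanishes when `D` has injective dimension at most `k`
over `S`. -/
lemma extZero_dualImage {k : ℕ} (hk : ∀ (A : Type u) [AddCommGroup A] [Module S A],
    ∀ j, k + 1 ≤ j → ExtZero S A D j) (n : ℕ) (M : Type u) [AddCommGroup M] [Module R M]
    [Module.Finite R M] (hM : ∀ i, 1 ≤ i → i ≤ n → ExtZero R M D i) (j : ℕ) (hj : k ≤ j + 1 + n) :
    ExtZero S (DualImage R M S D) D (j + 1) := by
  induction n generalizing M j with
  | zero =>
    exact extZero_left (DualImage R M S D).injective_subtype (LinearMap.exact_subtype_mkQ _)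
      (Submodule.mkQ_surjective _) (extZero_of_projective j) (hk _ _ (by omega))
  | succ n ih =>
    refine extZero_left (DualImage R M S D).injective_subtype
      (exact_rangeRestrict (exact_dualImage (hM 1 le_rfl (by omega)))) (LinearMap.surjective_rangeRestrict _)
      (extZero_of_projective j) (ih (Syzygy R M) (fun i hi hin => ?_) (j + 1) (by omega))
    obtain ⟨i, rfl⟩ := Nat.exists_eq_add_of_le' hi
    exact extZero_syzygy (hM (i + 2) (by omega) (by omega))

variable {M : Type u} [AddCommGroup M] [Module R M] [Module.Finite R M]

lemma exists_eq_eval_of_extZero (h : ExtZero S (DualImage R M S D) D 1)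
    (Φ : (M →ₗ[R] D) →ₗ[S] D) : ∃ x : M, ∀ f, Φ f = f x := by
  obtain ⟨Ψ, hΨ⟩ := (extZero_one_iff (R := S) (D := D) (f := (cover R M).lcomp S D)
    (g := ((presentation R M).lcomp S D).rangeRestrict) dual_cover_injective
    (exact_rangeRestrict exact_dual_cover) (LinearMap.surjective_rangeRestrict _)).mp h Φ
  obtain ⟨q, hq⟩ := exists_eq_eval Ψ
  refine ⟨cover R M q, fun f => ?_⟩
  exact (LinearMap.congr_fun hΨ f).symm.trans (hq ((cover R M).lcomp S D f))

/-- If `Ext¹(M, D) = 0`, then `M` is torsionless as soon as evaluation is onto for its syzygy. -/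
lemma eq_zero_of_forall_apply_eq_zero (hM : ExtZero R M D 1)
    (h : ExtZero S (DualImage R (Syzygy R M) S D) D 1) (x : M) (hx : ∀ f : M →ₗ[R] D, f x = 0) :
    x = 0 := by
  obtain ⟨p, rfl⟩ := cover_surjective R M x
  -- Evaluation at `p` kills `M*`, hence descends to a functional on the dual of the syzygy.
  obtain ⟨Φ, hΦ⟩ := exists_comp_eq_of_surjective
    (g := (Syzygy R M).subtype.lcomp S D) (dual_subtype_surjective hM)
    (LinearMap.applyₗ' S p : ((Fin (coverRank R M) → R) →ₗ[R] D) →ₗ[S] D) fun f hf => by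
      have hf' : f ∘ₗ presentation R M = 0 := by
        ext y
        exact LinearMap.congr_fun hf (cover R (Syzygy R M) _)
      obtain ⟨φ, rfl⟩ := exists_comp_cover_eq hf'
      exact hx φ
  obtain ⟨m, hm⟩ := exists_eq_eval_of_extZero h Φ
  have hpm : p - m = 0 := eq_zero_of_forall_dual S D fun f => by
    have h1 := LinearMap.congr_fun hΦ f
    have h2 := hm ((Syzygy R M).subtype.lcomp S D f)
    rw [map_sub, sub_eq_zero]
    exact h1.symm.trans h2
  rw [sub_eq_zero.mp hpm]
  exact m.2

end Reflexive

/-! ### Transposes of syzygies -/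

/-- In a sequence `X₀ → X₁ → X₂` with composite zero, where `X₀ → X₁` factors as `e : X₀ → K` followed
by the kernel `c` of `b : X₁ → X₂`, the homology `K / im e` is the kernel of the map from the cokernel
`X₁ / im a` onto the image of `b`. -/
lemma extZero_range {S : Type u} [Ring S] {X₀ X₁ X₂ K D : Type u} [AddCommGroup X₀] [Module S X₀]
    [AddCommGroup X₁] [Module S X₁] [AddCommGroup X₂] [Module S X₂] [AddCommGroup K] [Module S K]
    [AddCommGroup D] [Module S D] {a : X₀ →ₗ[S] X₁} {b : X₁ →ₗ[S] X₂} {e : X₀ →ₗ[S] K}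
    {c : K →ₗ[S] X₁} (hc : Function.Injective c) (hcb : Function.Exact c b) (hce : c ∘ₗ e = a)
    {j : ℕ} (hK : ExtZero S (K ⧸ LinearMap.range e) D j)
    (hX : ExtZero S (X₁ ⧸ LinearMap.range a) D (j + 1)) :
    ExtZero S (LinearMap.range b) D (j + 1) := by
  subst hce
  let κ : (K ⧸ LinearMap.range e) →ₗ[S] X₁ ⧸ LinearMap.range (c ∘ₗ e) :=
    Submodule.mapQ _ _ c (by
      rintro _ ⟨x, rfl⟩
      exact ⟨x, rfl⟩)
  let μ : (X₁ ⧸ LinearMap.range (c ∘ₗ e)) →ₗ[S] LinearMap.range b :=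
    Submodule.liftQ _ b.rangeRestrict (by
      rintro _ ⟨x, rfl⟩
      exact Subtype.ext (hcb.apply_apply_eq_zero (e x)))
  have hκ : Function.Injective κ := by
    rw [injective_iff_map_eq_zero]
    intro x hx
    obtain ⟨y, rfl⟩ := Submodule.Quotient.mk_surjective _ x
    obtain ⟨z, hz⟩ := (Submodule.Quotient.mk_eq_zero _).mp hx
    exact (Submodule.Quotient.mk_eq_zero _).mpr ⟨z, hc hz⟩
  have hκμ : Function.Exact κ μ := by
    intro x
    obtain ⟨y, rfl⟩ := Submodule.Quotient.mk_surjective _ x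
    constructor
    · intro hy
      obtain ⟨z, rfl⟩ := (hcb y).mp (congrArg Subtype.val hy)
      exact ⟨Submodule.Quotient.mk z, rfl⟩
    · rintro ⟨z, hz⟩
      obtain ⟨w, rfl⟩ := Submodule.Quotient.mk_surjective _ z
      rw [← hz]
      exact Subtype.ext (hcb.apply_apply_eq_zero w)
  have hμ : Function.Surjective μ := by
    rintro ⟨_, y, rfl⟩
    exact ⟨Submodule.Quotient.mk y, rfl⟩
  exact extZero_right hκ hκμ hμ hK hX

/-- Let `P₂ → P₁ → P₀` be an exact sequence of finitely generated free modules. Functionals on the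
image of `P₁* → P₂*` extend to `P₂*`: as functionals on `P₁*` they are evaluations at elements of
`P₁`, and these lie in the image of `P₂` since they vanish on the image of `P₀*`. -/
lemma exists_extend_range_dual {R S D : Type u} [Ring R] [Ring S] [AddCommGroup D] [Module R D]
    [Module S D] [SMulCommClass R S D] [IsRegularBimodule R S D] {l m n : ℕ}
    {d₂ : (Fin l → R) →ₗ[R] (Fin m → R)} {d₁ : (Fin m → R) →ₗ[R] (Fin n → R)}
    (hd : Function.Exact d₂ d₁) (Φ : LinearMap.range (d₂.lcomp S D) →ₗ[S] D) :
    ∃ Ψ : ((Fin l → R) →ₗ[R] D) →ₗ[S] D,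
      Ψ ∘ₗ (LinearMap.range (d₂.lcomp S D)).subtype = Φ := by
  obtain ⟨q, hq⟩ := exists_eq_eval (Φ ∘ₗ (d₂.lcomp S D).rangeRestrict)
  have hq0 : d₁ q = 0 := eq_zero_of_forall_dual S D fun h => by
    have h0 : (d₂.lcomp S D).rangeRestrict (d₁.lcomp S D h) = 0 :=
      Subtype.ext (LinearMap.ext fun x =>
        (congrArg h (hd.apply_apply_eq_zero x)).trans (map_zero h))
    have h1 := hq (d₁.lcomp S D h)
    rw [LinearMap.comp_apply, h0, map_zero] at h1
    exact h1.symm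
  obtain ⟨p, rfl⟩ := (hd q).mp hq0
  refine ⟨LinearMap.applyₗ' S p, LinearMap.ext ?_⟩
  rintro ⟨_, h, rfl⟩
  exact (hq h).symm

section Transpose

variable {R : Type u} [Ring R] [IsNoetherianRing R]
variable {S D : Type u} [Ring S] [AddCommGroup D] [Module R D] [Module S D] [SMulCommClass R S D]
variable {N : Type u} [AddCommGroup N] [Module R N] [Module.Finite R N]

variable (R S D N) in
/-- The dual of the syzygy `K` of `N` modulo the functionals that extend to `P₀`. It is `Ext¹(N, D)`
as an `S`-module. -/
noncomputable abbrev ExtensionObstruction : Type u :=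
  (Syzygy R N →ₗ[R] D) ⧸ LinearMap.range ((Syzygy R N).subtype.lcomp S D)

variable [IsRegularBimodule R S D]

/-- An element of `P₁` whose evaluation kills the image of `P₀*` maps to zero in the syzygy. -/
lemma cover_eq_zero_of_forall_dual {R : Type u} [Ring R] [IsNoetherianRing R] (S : Type u)
    {D : Type u} [Ring S] [AddCommGroup D] [Module R D] [Module S D] [IsRegularBimodule R S D]
    {N : Type u} [AddCommGroup N] [Module R N] [Module.Finite R N] {q : Fin (coverRank R (Syzygy R N)) → R}
    (hq : ∀ h : (Fin (coverRank R N) → R) →ₗ[R] D, h (presentation R N q) = 0) :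
    cover R (Syzygy R N) q = 0 :=
  Subtype.ext (eq_zero_of_forall_dual S D hq)

variable (S D N) in
lemma extZero_one_transpose_syzygy :
    ExtZero S (Transpose R (Syzygy R N) S D) D 1 :=
  (extZero_one_iff (R := S) (D := D) (f := (DualImage R (Syzygy R N) S D).subtype)
    (g := (DualImage R (Syzygy R N) S D).mkQ) (Submodule.injective_subtype _)
    (LinearMap.exact_subtype_mkQ _) (Submodule.mkQ_surjective _)).mpr
    (exists_extend_range_dual (exact_presentation R N))

/-- If `Ext¹(N, D)` has grade at least `n` and the transpose of `N` has vanishing `Ext` in degrees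
`1, …, n`, then the transpose of the syzygy of `N` has vanishing `Ext` in degrees
`1, …, n + 1`. -/
lemma extZero_transpose_syzygy {n : ℕ}
    (hE : ∀ j, j < n → ExtZero S (ExtensionObstruction R S D N) D j)
    (hT : ∀ j, 1 ≤ j → j ≤ n → ExtZero S (Transpose R N S D) D j) (j : ℕ) (hj : 1 ≤ j)
    (hjn : j ≤ n + 1) : ExtZero S (Transpose R (Syzygy R N) S D) D j := by
  obtain rfl | ⟨j, rfl⟩ : j = 1 ∨ ∃ i, j = i + 2 := by
    rcases j with _ | _ | j
    · omega
    · exact Or.inl rfl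
    · exact Or.inr ⟨j, rfl⟩
  · exact extZero_one_transpose_syzygy S D N
  · have hB : ExtZero S (DualImage R (Syzygy R N) S D) D (j + 1) :=
      extZero_range (a := (presentation R N).lcomp S D) (e := (Syzygy R N).subtype.lcomp S D)
        (c := (cover R (Syzygy R N)).lcomp S D) dual_cover_injective exact_dual_cover rfl
        (hE j (by omega)) (hT (j + 1) (by omega) (by omega))
    exact extZero_right (DualImage R (Syzygy R N) S D).injective_subtype
      (LinearMap.exact_subtype_mkQ _) (Submodule.mkQ_surjective _) hB
      (extZero_of_projective (j + 1))

/-- If the transpose of `N` is torsionless, then `Ext¹(N, D) = 0`. -/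
lemma extZero_one_of_transpose (h : ∀ t : Transpose R N S D,
    (∀ f : Transpose R N S D →ₗ[S] D, f t = 0) → t = 0) : ExtZero R N D 1 := by
  refine (extZero_one_iff (Syzygy R N).injective_subtype (LinearMap.exact_subtype_ker_map _)
    (cover_surjective R N)).mpr fun φ => ?_
  have ht := h (Submodule.Quotient.mk (φ ∘ₗ cover R (Syzygy R N))) fun f => by
    -- A functional on the transpose is evaluation at some `q` in `P₁` that dies in `P₀`.
    obtain ⟨q, hq⟩ := exists_eq_eval (f ∘ₗ (DualImage R N S D).mkQ)
    have hq0 : cover R (Syzygy R N) q = 0 := cover_eq_zero_of_forall_dual S fun h => by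
      refine (hq ((presentation R N).lcomp S D h)).symm.trans
        ((congrArg f ?_).trans (map_zero f))
      exact (Submodule.Quotient.mk_eq_zero _).mpr ⟨h, rfl⟩
    exact (hq (φ ∘ₗ cover R (Syzygy R N))).trans ((congrArg φ hq0).trans (map_zero φ))
  obtain ⟨ψ, hψ⟩ := (Submodule.Quotient.mk_eq_zero _).mp ht
  exact ⟨ψ, LinearMap.lcomp_injective_of_surjective (S := S) _
    (cover_surjective R (Syzygy R N)) hψ⟩

end Transpose

/-! ### The equivalence -/

section Main

variable {Λ : Type u} [Ring Λ]

/-- For an `i`-th syzygy `L` of a finitely generated right module, with `i ≤ k`, the transpose of `L`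
has vanishing `Ext` in degrees `1, …, i`. -/
lemma IsRightQuasiGorenstein.exists_syzygy [IsNoetherianRing Λᵐᵒᵖ] {k : ℕ}
    (hΛ : IsRightQuasiGorenstein Λ k) (N : ModuleCat.{u} Λᵐᵒᵖ) (hN : Module.Finite Λᵐᵒᵖ N)
    (i : ℕ) (hi : i ≤ k) :
    ∃ (L : ModuleCat.{u} Λᵐᵒᵖ) (_ : Module.Finite Λᵐᵒᵖ L),
      (∀ m, Nonempty (rightExt Λ N (i + m + 1) ≃ₗ[Λ] rightExt Λ L (m + 1))) ∧
      ∀ j, 1 ≤ j → j ≤ i → ExtZero Λ (Transpose Λᵐᵒᵖ L Λ Λ) Λ j := by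
  induction i with
  | zero =>
    refine ⟨N, hN, fun m => ?_, fun j hj hj0 => by omega⟩
    rw [zero_add]
    exact ⟨LinearEquiv.refl _ _⟩
  | succ i ih =>
    obtain ⟨L, hL, hExt, hT⟩ := ih (by omega)
    have hsub := (Syzygy Λᵐᵒᵖ L).injective_subtype
    have hex : Function.Exact (Syzygy Λᵐᵒᵖ L).subtype (cover Λᵐᵒᵖ L) :=
      LinearMap.exact_subtype_ker_map _
    have hsurj := cover_surjective Λᵐᵒᵖ L
    refine ⟨ModuleCat.of Λᵐᵒᵖ (Syzygy Λᵐᵒᵖ L),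
      inferInstanceAs (Module.Finite Λᵐᵒᵖ (Syzygy Λᵐᵒᵖ L)), fun m => ?_, ?_⟩
    · obtain ⟨e₁⟩ := hExt (m + 1)
      obtain ⟨e₂⟩ := rightExt_shift hsub hex hsurj m
      rw [show i + 1 + m + 1 = i + (m + 1) + 1 by omega]
      exact ⟨e₁.trans e₂.symm⟩
    · obtain ⟨e₁⟩ := hExt 0
      obtain ⟨e₂⟩ := rightExt_one hsub hex hsurj
      have hE : GradeGE (ModuleCat.of Λ (ExtensionObstruction Λᵐᵒᵖ Λ Λ L)) (i + 1) :=
        (hΛ N hN (i + 1) (by omega) hi).of_linearEquiv (e₁.trans e₂)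
      exact extZero_transpose_syzygy (N := L) (fun j hj => hE j (by omega)) hT

lemma isTorsionless_iff {M : Type u} [AddCommGroup M] [Module Λ M] :
    IsTorsionless Λ M ↔ ∀ x : M, (∀ f : M →ₗ[Λ] Λ, f x = 0) → x = 0 := by
  rw [IsTorsionless, injective_iff_map_eq_zero]
  exact forall_congr' fun x => imp_congr_left LinearMap.ext_iff

end Main

end QuasiGorenstein

theorem theorem2p3 (Λ : Type u) [Ring Λ] [IsNoetherianRing Λ] [IsNoetherianRing Λᵐᵒᵖ]
    (k : ℕ) (hk : 1 ≤ k) (hΛ : QuasiGorenstein.IsRightQuasiGorenstein Λ k) :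
    List.TFAE [
      HasInjectiveDimensionLE (ModuleCat.of Λᵐᵒᵖ Λ) k,
      ∀ M : ModuleCat.{u} Λ, Module.Finite Λ M →
        QuasiGorenstein.ReducedGradeGE M (k + 1) → QuasiGorenstein.IsReflexive Λ M,
      ∀ M : ModuleCat.{u} Λ, Module.Finite Λ M →
        QuasiGorenstein.ReducedGradeGE M (k + 1) → QuasiGorenstein.IsTorsionless Λ M] := by
  open QuasiGorenstein in
  tfae_have 1 → 2 := by
    intro hid M hM hgr
    have hid' (A : Type u) [AddCommGroup A] [Module Λᵐᵒᵖ A] (j : ℕ) (hj : k + 1 ≤ j) :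
        ExtZero Λᵐᵒᵖ A Λ j := hid.subsingleton _ _ j hj _
    have hB₁ : ExtZero Λᵐᵒᵖ (DualImage Λ M Λᵐᵒᵖ Λ) Λ 1 :=
      extZero_dualImage hid' k M (fun i hi hik => hgr i hi (by omega)) 0 (by omega)
    have hB₂ : ExtZero Λᵐᵒᵖ (DualImage Λ (Syzygy Λ M) Λᵐᵒᵖ Λ) Λ 1 := by
      refine extZero_dualImage hid' (k - 1) (Syzygy Λ M) (fun i hi hik => ?_) 0 (by omega)
      obtain ⟨i, rfl⟩ := Nat.exists_eq_add_of_le' hi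
      exact extZero_syzygy (hgr (i + 2) (by omega) (by omega))
    refine ⟨isTorsionless_iff.mpr
      (eq_zero_of_forall_apply_eq_zero (hgr 1 le_rfl (by omega)) hB₂), fun Φ => ?_⟩
    obtain ⟨x, hx⟩ := exists_eq_eval_of_extZero hB₁ Φ
    exact ⟨x, LinearMap.ext fun f => (hx f).symm⟩
  tfae_have 2 → 3 := fun h M hM hgr => (h M hM hgr).1
  tfae_have 3 → 1 := by
    intro h
    refine hasInjectiveDimensionLE_of_finite k _ fun N hN => ?_
    obtain ⟨L, hL, hExt, hT⟩ := hΛ.exists_syzygy N hN k le_rfl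
    obtain ⟨e⟩ := hExt 0
    have hTL := h (ModuleCat.of Λ (Transpose Λᵐᵒᵖ L Λ Λ))
      (inferInstanceAs (Module.Finite Λ (Transpose Λᵐᵒᵖ L Λ Λ)))
      fun j hj hjk => hT j hj (by omega)
    have hL1 : ExtZero Λᵐᵒᵖ L Λ 1 := extZero_one_of_transpose (isTorsionless_iff.mp hTL)
    have : Subsingleton (rightExt Λ L 1) := hL1
    exact e.toEquiv.subsingleton
  tfae_finish
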